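/- Let $K$ be an algebraically closed field of characteristic $p>0$, $p\neq 2$, and let $m,n\ge 0$. Let $K[c_{ij}]$ be the commutative superalgebra freely generated by $c_{ij}$, $1\le i,j\le m+n$, where $c_{ij}$ is even if $i,j\le m$ or $i,j>m$, and odd otherwise. Write the generic matrix as $C=(c_{ij})=\begin{pmatrix}C_{00}&C_{01}\\C_{10}&C_{11}\end{pmatrix}$, with $C_{00}$ of size $m\times m$ and $C_{11}$ of size $n\times n$. Let $K[G]$ be the localization of $K[c_{ij}]$ at $\det C_{00}$ and $\det C_{11}$; it is the coordinate superalgebra of the general linear supergroup $G=GL(m|n)$, with $G(A)=\mathrm{Hom}_{SAlg_K}(K[G],A)$ for every commutative superalgebra $A$ over $K$. For $g\in G(A)$ and $f\in K[G]$ put $f(g)=g(f)$; the product in $G(A)$ corresponds to multiplication of the matrices $(c_{ij}(g))$. Let $R\subseteq K[G]$ be the algebra of adjoint invariants, that is, of all $f\in K[G]$ such that $f(g_1^{-1}g_2g_1)=f(g_2)$ for every commutative superalgebra $A$ over $K$ and all $g_1,g_2\in G(A)$. Let $R_{pol}=R\cap K[c_{ij}]$ be its subalgebra of polynomial invariants.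 For an $r\times r$ matrix $M$ over a commutative ring define $\sigma_i(M)$ by $\det(1+tM)=\sum_i\sigma_i(M)t^i$. Then $\sigma_m(C_{00})$ and $\sigma_n(C_{11})$ are invertible in $K[G]$, the elements $\sigma_m(C_{00})^p$ and $\sigma_n(C_{11})^p$ lie in $R_{pol}$, and $$R=R_{pol}\left[\sigma_m(C_{00})^{\pm p},\ \sigma_n(C_{11})^{\pm p}\right].$$ That is, $R$ is the subalgebra of $K[G]$ generated by $R_{pol}$ and $\sigma_m(C_{00})^{\pm p}$, $\sigma_n(C_{11})^{\pm p}$; equivalently, $R$ consists exactly of the elements $a\,\sigma_m(C_{00})^{-pk}\,\sigma_n(C_{11})^{-pl}$ with $a\in R_{pol}$ and integers $k,l\ge 0$. -/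

import Mathlib

noncomputable section

namespace GLSuper

universe u

open Matrix

/-! ### Commutative superalgebras -/

/-- A `ℤ/2`-graded `K`-algebra `A = A₀ ⊕ A₁` is a commutative superalgebra if
`a b = (-1)^{|a||b|} b a` for homogeneous `a`, `b`, and odd elements square to zero.
(When `2` is invertible the second condition follows from the first.) -/
class IsCommSuperalgebra {K A : Type*} [CommRing K] [Ring A] [Algebra K A]
    (𝒜 : ZMod 2 → Submodule K A) [GradedAlgebra 𝒜] : Prop where
  super_comm : ∀ (i j : ZMod 2) (a b : A), a ∈ 𝒜 i → b ∈ 𝒜 j →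
    a * b = (-1 : ℤˣ) ^ (i * j) • (b * a)
  odd_sq_zero : ∀ a : A, a ∈ 𝒜 1 → a * a = 0

section Super

variable {K A : Type*} [CommRing K] [Ring A] [Algebra K A]
  (𝒜 : ZMod 2 → Submodule K A) [GradedAlgebra 𝒜]

/-- The even part of a superalgebra. -/
def evenPart : Subalgebra K A := SetLike.GradeZero.subalgebra 𝒜

theorem mem_evenPart {a : A} : a ∈ evenPart 𝒜 ↔ a ∈ 𝒜 0 := Iff.rfl

variable [IsCommSuperalgebra 𝒜]

theorem even_comm {a : A} (ha : a ∈ 𝒜 0) (b : A) : a * b = b * a := by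
  classical
  induction b using DirectSum.Decomposition.inductionOn 𝒜 with
  | zero => simp
  | @homogeneous i m =>
    have := IsCommSuperalgebra.super_comm (𝒜 := 𝒜) 0 i a m ha m.2
    simpa using this
  | add x y hx hy => rw [mul_add, add_mul, hx, hy]

instance : CommRing (evenPart 𝒜) where
  mul_comm a b := Subtype.ext (even_comm 𝒜 a.2 b)

theorem odd_mul_odd_isNilpotent {a b : A} (_ha : a ∈ 𝒜 1) (hb : b ∈ 𝒜 1)
    (h : a * b ∈ evenPart 𝒜) : IsNilpotent (⟨a * b, h⟩ : evenPart 𝒜) := by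
  refine ⟨2, Subtype.ext ?_⟩
  change (a * b) ^ 2 = 0
  rw [pow_two, mul_assoc, ← even_comm 𝒜 h b, mul_assoc a b b,
    IsCommSuperalgebra.odd_sq_zero (𝒜 := 𝒜) b hb, mul_zero, mul_zero]

end Super

/-! ### Even supermatrices of format `(m|n)` -/

/-- The parity of an index: `Fin m` is even, `Fin n` is odd. -/
def par {m n : ℕ} : Fin m ⊕ Fin n → ZMod 2 := Sum.elim (fun _ => 0) (fun _ => 1)

section Matrices

variable {K A : Type*} [CommRing K] [Ring A] [Algebra K A]
  (𝒜 : ZMod 2 → Submodule K A) [GradedAlgebra 𝒜] (m n : ℕ)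

/-- The ring of even supermatrices over `A`: the entries of the two diagonal blocks are even
and the entries of the two off-diagonal blocks are odd. -/
def evenSupermatrix : Subring (Matrix (Fin m ⊕ Fin n) (Fin m ⊕ Fin n) A) where
  carrier := {X | ∀ i j, X i j ∈ 𝒜 (par i + par j)}
  mul_mem' := by
    intro X Y hX hY i j
    rw [Matrix.mul_apply]
    refine Submodule.sum_mem _ fun k _ => ?_
    have h := SetLike.GradedMul.mul_mem (hX i k) (hY k j)
    have e : par i + par k + (par k + par j) = par i + par j := by
      rw [add_assoc, ← add_assoc (par k), CharTwo.add_self_eq_zero, zero_add]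
    rwa [e] at h
  one_mem' := by
    intro i j
    by_cases h : i = j
    · subst h
      rw [Matrix.one_apply_eq, CharTwo.add_self_eq_zero]
      exact SetLike.GradedOne.one_mem
    · rw [Matrix.one_apply_ne h]
      exact Submodule.zero_mem _
  add_mem' := fun hX hY i j => Submodule.add_mem _ (hX i j) (hY i j)
  zero_mem' := fun _ _ => Submodule.zero_mem _
  neg_mem' := fun hX i j => Submodule.neg_mem _ (hX i j)

variable {𝒜 m n}

/-- The block `X₀₀` of an even supermatrix, as a matrix over the even part of `A`. -/
def block00 (X : evenSupermatrix 𝒜 m n) : Matrix (Fin m) (Fin m) (evenPart 𝒜) :=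
  Matrix.of fun i j => ⟨X.1 (.inl i) (.inl j), X.2 (.inl i) (.inl j)⟩

/-- The block `X₁₁` of an even supermatrix, as a matrix over the even part of `A`. -/
def block11 (X : evenSupermatrix 𝒜 m n) : Matrix (Fin n) (Fin n) (evenPart 𝒜) :=
  Matrix.of fun i j => ⟨X.1 (.inr i) (.inr j), X.2 (.inr i) (.inr j)⟩

theorem isUnit_det_of_sub_isNilpotent {R ι : Type*} [CommRing R] [Fintype ι] [DecidableEq ι]
    {M N : Matrix ι ι R} (h : ∀ i j, IsNilpotent (M i j - N i j)) (hM : IsUnit M.det) :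
    IsUnit N.det := by
  have key : M.map (Ideal.Quotient.mk (nilradical R)) = N.map (Ideal.Quotient.mk (nilradical R)) := by
    ext i j
    exact Ideal.Quotient.eq.2 (h i j)
  have e : Ideal.Quotient.mk (nilradical R) M.det = Ideal.Quotient.mk (nilradical R) N.det := by
    rw [RingHom.map_det, RingHom.map_det]
    exact congrArg Matrix.det key
  have hnil : IsNilpotent (N.det - M.det) := Ideal.Quotient.eq.1 e.symm
  have := hnil.isUnit_add_left_of_commute hM (Commute.all _ _)
  simpa using this

theorem block00_one : block00 (1 : evenSupermatrix 𝒜 m n) = 1 := by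
  ext i j
  by_cases h : i = j <;> simp [block00, Matrix.one_apply, h]

theorem block11_one : block11 (1 : evenSupermatrix 𝒜 m n) = 1 := by
  ext i j
  by_cases h : i = j <;> simp [block11, Matrix.one_apply, h]

variable [IsCommSuperalgebra 𝒜]

theorem block00_mul (X Y : evenSupermatrix 𝒜 m n) (i j) :
    IsNilpotent (block00 (X * Y) i j - (block00 X * block00 Y) i j) := by
  have hmem : ∀ k, X.1 (.inl i) (.inr k) * Y.1 (.inr k) (.inl j) ∈ evenPart 𝒜 := fun k =>
    SetLike.GradedMul.mul_mem (X.2 (.inl i) (.inr k)) (Y.2 (.inr k) (.inl j))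
  have e : block00 (X * Y) i j - (block00 X * block00 Y) i j =
      ∑ k, (⟨_, hmem k⟩ : evenPart 𝒜) := by
    apply Subtype.ext
    simp [block00, Matrix.mul_apply]
  rw [e]
  exact (nilradical (evenPart 𝒜)).sum_mem fun k _ =>
    odd_mul_odd_isNilpotent 𝒜 (X.2 (.inl i) (.inr k)) (Y.2 (.inr k) (.inl j)) (hmem k)

theorem block11_mul (X Y : evenSupermatrix 𝒜 m n) (i j) :
    IsNilpotent (block11 (X * Y) i j - (block11 X * block11 Y) i j) := by
  have hmem : ∀ k, X.1 (.inr i) (.inl k) * Y.1 (.inl k) (.inr j) ∈ evenPart 𝒜 := fun k =>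
    SetLike.GradedMul.mul_mem (X.2 (.inr i) (.inl k)) (Y.2 (.inl k) (.inr j))
  have e : block11 (X * Y) i j - (block11 X * block11 Y) i j =
      ∑ k, (⟨_, hmem k⟩ : evenPart 𝒜) := by
    apply Subtype.ext
    simp [block11, Matrix.mul_apply]
  rw [e]
  exact (nilradical (evenPart 𝒜)).sum_mem fun k _ =>
    odd_mul_odd_isNilpotent 𝒜 (X.2 (.inr i) (.inl k)) (Y.2 (.inl k) (.inr j)) (hmem k)

/-- The block diagonal supermatrix with given blocks. -/
def blockDiag : Matrix (Fin m) (Fin m) (evenPart 𝒜) × Matrix (Fin n) (Fin n) (evenPart 𝒜) →*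
    evenSupermatrix 𝒜 m n where
  toFun M := ⟨fromBlocks (M.1.map Subtype.val) 0 0 (M.2.map Subtype.val), by
    rintro (i | i) (j | j)
    · exact (M.1 i j).2
    · exact Submodule.zero_mem _
    · exact Submodule.zero_mem _
    · exact (M.2 i j).2⟩
  map_one' := by
    apply Subtype.ext
    have h0 : (1 : Matrix (Fin m) (Fin m) (evenPart 𝒜)).map Subtype.val = (1 : Matrix _ _ A) :=
      Matrix.map_one _ rfl rfl
    have h1 : (1 : Matrix (Fin n) (Fin n) (evenPart 𝒜)).map Subtype.val = (1 : Matrix _ _ A) :=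
      Matrix.map_one _ rfl rfl
    simp only [Prod.fst_one, Prod.snd_one, h0, h1, fromBlocks_one, Subring.coe_one]
  map_mul' M N := by
    apply Subtype.ext
    have h0 : (M.1 * N.1).map Subtype.val =
        (M.1.map Subtype.val * N.1.map Subtype.val : Matrix _ _ A) :=
      Matrix.map_mul (f := (evenPart 𝒜).val)
    have h1 : (M.2 * N.2).map Subtype.val =
        (M.2.map Subtype.val * N.2.map Subtype.val : Matrix _ _ A) :=
      Matrix.map_mul (f := (evenPart 𝒜).val)
    simp [fromBlocks_multiply, h0, h1]

theorem isUnit_blockDiag {M : Matrix (Fin m) (Fin m) (evenPart 𝒜)}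
    {N : Matrix (Fin n) (Fin n) (evenPart 𝒜)} (hM : IsUnit M.det) (hN : IsUnit N.det) :
    IsUnit (blockDiag (M, N)) :=
  (Prod.isUnit_iff.2 ⟨(Matrix.isUnit_iff_isUnit_det M).2 hM,
    (Matrix.isUnit_iff_isUnit_det N).2 hN⟩).map blockDiag

theorem isUnit_of_blocks_eq_one (Z : evenSupermatrix 𝒜 m n) (h0 : block00 Z = 1)
    (h1 : block11 Z = 1) : IsUnit Z := by
  have hZ : Z.1 = fromBlocks 1 Z.1.toBlocks₁₂ Z.1.toBlocks₂₁ 1 := by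
    ext i j
    rcases i with i | i <;> rcases j with j | j
    · simpa [block00, Matrix.one_apply, apply_ite] using
        congrArg Subtype.val (congrFun (congrFun h0 i) j)
    · rfl
    · rfl
    · simpa [block11, Matrix.one_apply, apply_ite] using
        congrArg Subtype.val (congrFun (congrFun h1 i) j)
  have h2 : (2 - Z : evenSupermatrix 𝒜 m n).1 = fromBlocks 1 (-Z.1.toBlocks₁₂) (-Z.1.toBlocks₂₁) 1 := by
    have : (2 - Z : evenSupermatrix 𝒜 m n).1 = 1 + 1 - Z.1 := by
      rw [← one_add_one_eq_two]
      rfl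
    rw [this]
    conv_lhs => rw [hZ]
    rw [← fromBlocks_one, fromBlocks_add, sub_eq_add_neg, fromBlocks_neg,
      fromBlocks_add]
    simp
  have hW : Z * (2 - Z) = blockDiag (block00 (Z * (2 - Z)), block11 (Z * (2 - Z))) := by
    apply Subtype.ext
    have e : (Z * (2 - Z)).1 = fromBlocks (1 - Z.1.toBlocks₁₂ * Z.1.toBlocks₂₁) 0 0
        (1 - Z.1.toBlocks₂₁ * Z.1.toBlocks₁₂) := by
      change Z.1 * (2 - Z : evenSupermatrix 𝒜 m n).1 = _
      rw [h2]
      conv_lhs => rw [hZ]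
      rw [fromBlocks_multiply]
      simp [sub_eq_add_neg, add_comm]
    ext i j
    rcases i with i | i <;> rcases j with j | j
    · rfl
    · rw [e]; rfl
    · rw [e]; rfl
    · rfl
  have b0 : block00 (2 - Z) = 1 := by
    ext i j
    change (2 - Z : evenSupermatrix 𝒜 m n).1 (.inl i) (.inl j) = _
    rw [h2]
    by_cases h : i = j <;> simp [Matrix.one_apply, h]
  have b1 : block11 (2 - Z) = 1 := by
    ext i j
    change (2 - Z : evenSupermatrix 𝒜 m n).1 (.inr i) (.inr j) = _
    rw [h2]
    by_cases h : i = j <;> simp [Matrix.one_apply, h]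
  have u : IsUnit (Z * (2 - Z)) := by
    rw [hW]
    apply isUnit_blockDiag
    · refine isUnit_det_of_sub_isNilpotent (M := 1) (fun i j => ?_) (by simp)
      have := (block00_mul Z (2 - Z) i j).neg
      rwa [h0, b0, one_mul, neg_sub] at this
    · refine isUnit_det_of_sub_isNilpotent (M := 1) (fun i j => ?_) (by simp)
      have := (block11_mul Z (2 - Z) i j).neg
      rwa [h1, b1, one_mul, neg_sub] at this
  have hc : Commute Z (2 - Z) := by
    change Z * (2 - Z) = (2 - Z) * Z
    noncomm_ring
  exact (hc.isUnit_mul_iff.1 u).1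

/-- An even supermatrix is invertible iff both of its diagonal blocks are. -/
theorem isUnit_evenSupermatrix_iff (X : evenSupermatrix 𝒜 m n) :
    IsUnit X ↔ IsUnit (block00 X).det ∧ IsUnit (block11 X).det := by
  constructor
  · rintro ⟨u, rfl⟩
    constructor
    · have : IsUnit (block00 u.1 * block00 u.2).det := by
        refine isUnit_det_of_sub_isNilpotent (fun i j => block00_mul u.1 u.2 i j) ?_
        rw [u.val_inv, block00_one, det_one]
        exact isUnit_one
      rw [det_mul] at this
      exact isUnit_of_mul_isUnit_left this
    · have : IsUnit (block11 u.1 * block11 u.2).det := by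
        refine isUnit_det_of_sub_isNilpotent (fun i j => block11_mul u.1 u.2 i j) ?_
        rw [u.val_inv, block11_one, det_one]
        exact isUnit_one
      rw [det_mul] at this
      exact isUnit_of_mul_isUnit_left this
  · rintro ⟨h0, h1⟩
    obtain ⟨D, hD⟩ := isUnit_blockDiag h0 h1
    obtain ⟨E, hE⟩ : ∃ E : evenSupermatrix 𝒜 m n,
        E = blockDiag ((block00 X)⁻¹, (block11 X)⁻¹) := ⟨_, rfl⟩
    have hDE : D * E = 1 := by
      rw [hD, hE, ← map_mul, Prod.mk_mul_mk, Matrix.mul_nonsing_inv _ h0,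
        Matrix.mul_nonsing_inv _ h1]
      exact map_one _
    have hE' : E = (D⁻¹ : (evenSupermatrix 𝒜 m n)ˣ) := Units.eq_inv_of_mul_eq_one_left hDE
    have z0 : block00 (X * E) = 1 := by
      rw [← Matrix.mul_nonsing_inv _ h0, hE]
      ext i j
      simp [block00, blockDiag, Matrix.mul_apply]
    have z1 : block11 (X * E) = 1 := by
      rw [← Matrix.mul_nonsing_inv _ h1, hE]
      ext i j
      simp [block11, blockDiag, Matrix.mul_apply]
    have u := isUnit_of_blocks_eq_one _ z0 z1
    rw [hE'] at u
    exact (Units.isUnit_mul_units X D⁻¹).1 u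

end Matrices

/-! ### The coordinate superalgebra `K[G]` of `G = GL(m|n)` -/

section Coord

variable (K : Type u) [Field K] (m n : ℕ)

/-- The indices of the even generators `c_ij`. -/
abbrev EvenIdx := (Fin m × Fin m) ⊕ (Fin n × Fin n)

/-- The indices of the odd generators `c_ij`. -/
abbrev OddIdx := (Fin m × Fin n) ⊕ (Fin n × Fin m)

/-- `det C₀₀ * det C₁₁`, a polynomial in the even generators. -/
def detProd : MvPolynomial (EvenIdx m n) K :=
  (Matrix.of fun i j : Fin m => (MvPolynomial.X (.inl (i, j)) : MvPolynomial (EvenIdx m n) K)).det *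
  (Matrix.of fun i j : Fin n => (MvPolynomial.X (.inr (i, j)) : MvPolynomial (EvenIdx m n) K)).det

/-- The polynomial ring in the even `c_ij`, localized at `det C₀₀` and `det C₁₁`. -/
abbrev EvenCoord := Localization.Away (detProd K m n)

/-- The coordinate superalgebra `K[G]`: the exterior algebra on the odd generators `c_ij` over the
localization at `det C₀₀` and `det C₁₁` of the polynomial ring in the even generators `c_ij`, i.e.
the localization at `det C₀₀`, `det C₁₁` of the commutative superalgebra freely generated by the
`c_ij`. -/
abbrev CoordRing := ExteriorAlgebra (EvenCoord K m n) (OddIdx m n → EvenCoord K m n)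

/-- The even (`i = 0`) and the odd (`i = 1`) part of `K[G]`. -/
def coordPart (i : ZMod 2) : Submodule K (CoordRing K m n) :=
  (CliffordAlgebra.evenOdd
    (0 : QuadraticForm (EvenCoord K m n) (OddIdx m n → EvenCoord K m n)) i).restrictScalars K

instance : GradedAlgebra (coordPart K m n) where
  one_mem := SetLike.GradedOne.one_mem (A := CliffordAlgebra.evenOdd
    (0 : QuadraticForm (EvenCoord K m n) (OddIdx m n → EvenCoord K m n)))
  mul_mem _ _ _ _ ha hb := SetLike.GradedMul.mul_mem (A := CliffordAlgebra.evenOdd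
    (0 : QuadraticForm (EvenCoord K m n) (OddIdx m n → EvenCoord K m n))) ha hb
  decompose' := DirectSum.Decomposition.decompose' (ℳ := CliffordAlgebra.evenOdd
    (0 : QuadraticForm (EvenCoord K m n) (OddIdx m n → EvenCoord K m n)))
  left_inv := DirectSum.Decomposition.left_inv (ℳ := CliffordAlgebra.evenOdd
    (0 : QuadraticForm (EvenCoord K m n) (OddIdx m n → EvenCoord K m n)))
  right_inv := DirectSum.Decomposition.right_inv (ℳ := CliffordAlgebra.evenOdd
    (0 : QuadraticForm (EvenCoord K m n) (OddIdx m n → EvenCoord K m n)))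

theorem coord_super_comm (i j : ZMod 2) (a b : CoordRing K m n) (ha : a ∈ coordPart K m n i)
    (hb : b ∈ coordPart K m n j) : a * b = (-1 : ℤˣ) ^ (i * j) • (b * a) := by
  have h := CliffordAlgebra.map_mul_map_of_isOrtho_of_mem_evenOdd
    (QuadraticMap.Isometry.id
      (0 : QuadraticForm (EvenCoord K m n) (OddIdx m n → EvenCoord K m n)))
    (QuadraticMap.Isometry.id
      (0 : QuadraticForm (EvenCoord K m n) (OddIdx m n → EvenCoord K m n)))
    (fun x y => by simp [QuadraticMap.IsOrtho]) a b ha hb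
  rw [CliffordAlgebra.map_id, AlgHom.id_apply, AlgHom.id_apply, mul_comm j i] at h
  exact h

/-- `K[G]` is itself a commutative superalgebra. -/
instance : IsCommSuperalgebra (coordPart K m n) where
  super_comm := coord_super_comm K m n
  odd_sq_zero a ha := by
    have anti : ∀ x y : CoordRing K m n, x ∈ coordPart K m n 1 → y ∈ coordPart K m n 1 →
        x * y + y * x = 0 := fun x y hx hy => by
      rw [coord_super_comm K m n 1 1 x y hx hy]
      simp
    have add_sq : ∀ x y : CoordRing K m n, x ∈ coordPart K m n 1 → y ∈ coordPart K m n 1 →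
        x * x = 0 → y * y = 0 → (x + y) * (x + y) = 0 := fun x y hx hy h1 h2 => by
      have := anti x y hx hy
      rw [add_mul, mul_add, mul_add, h1, h2, zero_add, add_zero, this]
    change a ∈ CliffordAlgebra.evenOdd _ 1 at ha
    unfold CliffordAlgebra.evenOdd at ha
    induction ha using Submodule.iSup_induction' with
    | zero => rw [mul_zero]
    | add x y hx hy h1 h2 => exact add_sq x y hx hy h1 h2
    | mem k x hx =>
      obtain ⟨k, hk⟩ := k
      dsimp only at hx
      obtain _ | l := k
      · exact absurd hk (by decide)
      rw [pow_succ'] at hx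
      induction hx using Submodule.mul_induction_on' with
      | mem_mul_mem u hu y hy =>
        obtain ⟨v, rfl⟩ := hu
        have hl : ((l : ℕ) : ZMod 2) = 0 := by
          rw [Nat.cast_succ] at hk
          exact add_eq_right.1 hk
        have hy0 : y ∈ coordPart K m n 0 :=
          Submodule.mem_iSup_of_mem (⟨l, hl⟩ : { n : ℕ // (n : ZMod 2) = 0 }) hy
        have hc := coord_super_comm K m n 0 1 y _ hy0 (CliffordAlgebra.ι_mem_evenOdd_one _ v)
        rw [zero_mul, uzpow_zero, one_smul] at hc
        rw [mul_assoc, ← mul_assoc y, hc, mul_assoc, ← mul_assoc, CliffordAlgebra.ι_sq_scalar]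
        simp
      | add x hx y hy h1 h2 =>
        rw [← pow_succ'] at hx hy
        exact add_sq x y
          (Submodule.mem_iSup_of_mem (⟨l + 1, hk⟩ : { n : ℕ // (n : ZMod 2) = 1 }) hx)
          (Submodule.mem_iSup_of_mem (⟨l + 1, hk⟩ : { n : ℕ // (n : ZMod 2) = 1 }) hy) h1 h2

/-- The block `C₀₀` of the generic matrix (its entries lie in a commutative subring of `K[G]`). -/
def C00 : Matrix (Fin m) (Fin m) (EvenCoord K m n) :=
  Matrix.of fun i j => algebraMap (MvPolynomial (EvenIdx m n) K) _ (MvPolynomial.X (.inl (i, j)))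

/-- The block `C₁₁` of the generic matrix (its entries lie in a commutative subring of `K[G]`). -/
def C11 : Matrix (Fin n) (Fin n) (EvenCoord K m n) :=
  Matrix.of fun i j => algebraMap (MvPolynomial (EvenIdx m n) K) _ (MvPolynomial.X (.inr (i, j)))

/-- The odd block `C₀₁` of the generic matrix. -/
def C01 : Matrix (Fin m) (Fin n) (CoordRing K m n) :=
  Matrix.of fun i j => ExteriorAlgebra.ι _ (Pi.single (.inl (i, j)) 1)

/-- The odd block `C₁₀` of the generic matrix. -/
def C10 : Matrix (Fin n) (Fin m) (CoordRing K m n) :=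
  Matrix.of fun i j => ExteriorAlgebra.ι _ (Pi.single (.inr (i, j)) 1)

/-- The generic matrix `C = (c_ij)`. -/
def genericMatrix : Matrix (Fin m ⊕ Fin n) (Fin m ⊕ Fin n) (CoordRing K m n) :=
  fromBlocks ((C00 K m n).map (algebraMap _ _)) (C01 K m n) (C10 K m n)
    ((C11 K m n).map (algebraMap _ _))

theorem genericMatrix_mem (i j : Fin m ⊕ Fin n) :
    genericMatrix K m n i j ∈ coordPart K m n (par i + par j) := by
  rcases i with i | i <;> rcases j with j | j
  · exact (CliffordAlgebra.one_le_evenOdd_zero _) (Submodule.algebraMap_mem _)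
  · exact CliffordAlgebra.ι_mem_evenOdd_one _ _
  · exact CliffordAlgebra.ι_mem_evenOdd_one _ _
  · exact (CliffordAlgebra.one_le_evenOdd_zero _) (Submodule.algebraMap_mem _)

theorem algebraMap_detProd :
    algebraMap _ (EvenCoord K m n) (detProd K m n) = (C00 K m n).det * (C11 K m n).det := by
  refine (map_mul (algebraMap _ (EvenCoord K m n)) _ _).trans (congrArg₂ (· * ·) ?_ ?_)
  · exact RingHom.map_det _ _
  · exact RingHom.map_det _ _

theorem isUnit_det_C00 : IsUnit (C00 K m n).det :=
  isUnit_of_mul_isUnit_left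
    (algebraMap_detProd K m n ▸ IsLocalization.Away.algebraMap_isUnit (detProd K m n))

theorem isUnit_det_C11 : IsUnit (C11 K m n).det :=
  isUnit_of_mul_isUnit_right
    (algebraMap_detProd K m n ▸ IsLocalization.Away.algebraMap_isUnit (detProd K m n))

end Coord

/-! ### The group functor `GL(m|n)` -/

section Points

variable {K : Type u} [Field K] {A : Type*} [Ring A] [Algebra K A]
  (m n : ℕ) (𝒜 : ZMod 2 → Submodule K A) [GradedAlgebra 𝒜]

/-- `G(A) = Hom_{SAlg_K}(K[G], A)`: the parity preserving `K`-algebra homomorphisms. -/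
structure GLPoint where
  /-- The underlying homomorphism. For `g ∈ G(A)` and `f ∈ K[G]`, the value `f(g)` is
  `g.hom f`. -/
  hom : CoordRing K m n →ₐ[K] A
  hom_mem : ∀ (i : ZMod 2) (f : CoordRing K m n), f ∈ coordPart K m n i → hom f ∈ 𝒜 i

variable {m n 𝒜}

/-- The even supermatrix `(g(c_ij))` of a point `g ∈ G(A)`. -/
def GLPoint.toMatrix (g : GLPoint m n 𝒜) : evenSupermatrix 𝒜 m n :=
  ⟨(genericMatrix K m n).map g.hom, fun i j => g.hom_mem _ _ (genericMatrix_mem K m n i j)⟩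

/-- A point restricted to the even generators. -/
def GLPoint.evenHom (g : GLPoint m n 𝒜) : EvenCoord K m n →ₐ[K] evenPart 𝒜 :=
  (g.hom.comp (IsScalarTower.toAlgHom K (EvenCoord K m n) (CoordRing K m n))).codRestrict _
    fun s => g.hom_mem 0 _ ((CliffordAlgebra.one_le_evenOdd_zero _) (Submodule.algebraMap_mem s))

theorem GLPoint.ext_matrix {g h : GLPoint m n 𝒜} (e : g.toMatrix = h.toMatrix) : g = h := by
  have key : ∀ i j, g.hom (genericMatrix K m n i j) = h.hom (genericMatrix K m n i j) :=
    fun i j => congrFun (congrFun (congrArg Subtype.val e) i) j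
  have hs : (g.hom.toRingHom.comp (algebraMap (EvenCoord K m n) (CoordRing K m n))) =
      h.hom.toRingHom.comp (algebraMap (EvenCoord K m n) (CoordRing K m n)) := by
    refine IsLocalization.ringHom_ext (Submonoid.powers (detProd K m n)) ?_
    refine MvPolynomial.ringHom_ext (fun r => ?_) ?_
    · have e1 : algebraMap (EvenCoord K m n) (CoordRing K m n)
          (algebraMap (MvPolynomial (EvenIdx m n) K) _ (MvPolynomial.C r)) =
          algebraMap K _ r := by
        rw [← MvPolynomial.algebraMap_eq, ← IsScalarTower.algebraMap_apply,
          ← IsScalarTower.algebraMap_apply]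
      change g.hom (algebraMap _ _ _) = h.hom (algebraMap _ _ _)
      erw [e1]
      rw [g.hom.commutes, h.hom.commutes]
    · rintro (⟨i, j⟩ | ⟨i, j⟩)
      · exact key (.inl i) (.inl j)
      · exact key (.inr i) (.inr j)
  have hs' : ∀ s, g.hom (algebraMap (EvenCoord K m n) (CoordRing K m n) s) =
      h.hom (algebraMap (EvenCoord K m n) (CoordRing K m n) s) := fun s => RingHom.congr_fun hs s
  have hh : g.hom = h.hom := by
    ext f
    induction f using ExteriorAlgebra.induction with
    | algebraMap s => exact hs' s
    | ι x =>
      rw [pi_eq_sum_univ' x]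
      simp only [map_sum]
      refine Finset.sum_congr rfl fun o _ => ?_
      rw [map_smul, Algebra.smul_def, map_mul, map_mul, hs']
      congr 1
      rcases o with ⟨i, j⟩ | ⟨i, j⟩
      · exact key (.inl i) (.inr j)
      · exact key (.inr i) (.inl j)
    | mul a b ha hb => rw [map_mul, map_mul, ha, hb]
    | add a b ha hb => rw [map_add, map_add, ha, hb]
  cases g
  cases h
  cases hh
  rfl

variable [IsCommSuperalgebra 𝒜]

theorem GLPoint.isUnit_toMatrix (g : GLPoint m n 𝒜) : IsUnit g.toMatrix := by
  rw [isUnit_evenSupermatrix_iff]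
  constructor
  · have := (isUnit_det_C00 K m n).map g.evenHom
    rw [AlgHom.map_det] at this
    exact this
  · have := (isUnit_det_C11 K m n).map g.evenHom
    rw [AlgHom.map_det] at this
    exact this

/-- The specialization of the even generators at a supermatrix with invertible diagonal blocks. -/
def evalEven (X : (evenSupermatrix 𝒜 m n)ˣ) : EvenCoord K m n →ₐ[K] evenPart 𝒜 :=
  IsLocalization.liftAlgHom (M := Submonoid.powers (detProd K m n))
    (f := MvPolynomial.aeval (Sum.elim (fun ij => block00 X.1 ij.1 ij.2)
      (fun ij => block11 X.1 ij.1 ij.2))) (by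
    have h := (isUnit_evenSupermatrix_iff X.1).1 X.isUnit
    have e : MvPolynomial.aeval (Sum.elim (fun ij => block00 X.1 ij.1 ij.2)
        (fun ij => block11 X.1 ij.1 ij.2)) (detProd K m n) =
        (block00 X.1).det * (block11 X.1).det := by
      unfold detProd
      rw [map_mul, AlgHom.map_det, AlgHom.map_det]
      congr 2 <;> ext i j <;> simp
    rintro ⟨_, k, rfl⟩
    simp only [map_pow]
    refine IsUnit.pow k ?_
    erw [e]
    exact h.1.mul h.2)

/-- The specialization of the generic matrix at an invertible even supermatrix. -/
def evalHom (X : (evenSupermatrix 𝒜 m n)ˣ) : CoordRing K m n →ₐ[K] A :=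
  letI : Algebra (EvenCoord K m n) A :=
    ((evenPart 𝒜).val.toRingHom.comp (evalEven X).toRingHom).toAlgebra'
      fun s a => even_comm 𝒜 (evalEven X s).2 a
  haveI : IsScalarTower K (EvenCoord K m n) A := IsScalarTower.of_algebraMap_eq fun r => by
    change _ = ((evalEven X (algebraMap _ _ r) : evenPart 𝒜) : A)
    rw [(evalEven X).commutes]
    rfl
  (ExteriorAlgebra.lift (EvenCoord K m n)
    ⟨Fintype.linearCombination (EvenCoord K m n) (Sum.elim
      (fun ij : Fin m × Fin n => X.1.1 (.inl ij.1) (.inr ij.2))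
      (fun ij : Fin n × Fin m => X.1.1 (.inr ij.1) (.inl ij.2))), fun v => by
      refine IsCommSuperalgebra.odd_sq_zero (𝒜 := 𝒜) _ ?_
      rw [Fintype.linearCombination_apply]
      refine Submodule.sum_mem _ fun o _ => ?_
      rw [Algebra.smul_def]
      have h := SetLike.GradedMul.mul_mem (A := 𝒜) (i := 0) (j := 1) (evalEven X (v o)).2
        (gj := Sum.elim
          (fun ij : Fin m × Fin n => X.1.1 (.inl ij.1) (.inr ij.2))
          (fun ij : Fin n × Fin m => X.1.1 (.inr ij.1) (.inl ij.2)) o) (by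
          rcases o with ⟨i, j⟩ | ⟨i, j⟩
          · exact X.1.2 (.inl i) (.inr j)
          · exact X.1.2 (.inr i) (.inl j))
      rwa [zero_add] at h⟩).restrictScalars K

theorem evalHom_algebraMap (X : (evenSupermatrix 𝒜 m n)ˣ) (s : EvenCoord K m n) :
    evalHom X (algebraMap _ _ s) = (evalEven X s : A) := by
  let : Algebra (EvenCoord K m n) A :=
    ((evenPart 𝒜).val.toRingHom.comp (evalEven X).toRingHom).toAlgebra'
      fun s a => even_comm 𝒜 (evalEven X s).2 a
  exact AlgHom.commutes (ExteriorAlgebra.lift (EvenCoord K m n) _) s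

theorem evalHom_ι (X : (evenSupermatrix 𝒜 m n)ˣ) (v : OddIdx m n → EvenCoord K m n) :
    evalHom X (ExteriorAlgebra.ι _ v) = ∑ o, (evalEven X (v o) : A) * Sum.elim
      (fun ij : Fin m × Fin n => X.1.1 (.inl ij.1) (.inr ij.2))
      (fun ij : Fin n × Fin m => X.1.1 (.inr ij.1) (.inl ij.2)) o := by
  let : Algebra (EvenCoord K m n) A :=
    ((evenPart 𝒜).val.toRingHom.comp (evalEven X).toRingHom).toAlgebra'
      fun s a => even_comm 𝒜 (evalEven X s).2 a
  exact ExteriorAlgebra.lift_ι_apply (EvenCoord K m n) _ _ v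

theorem evalHom_ι_mem (X : (evenSupermatrix 𝒜 m n)ˣ) (v : OddIdx m n → EvenCoord K m n) :
    evalHom X (ExteriorAlgebra.ι _ v) ∈ 𝒜 1 := by
  rw [evalHom_ι]
  refine Submodule.sum_mem _ fun o _ => ?_
  have h := SetLike.GradedMul.mul_mem (A := 𝒜) (i := 0) (j := 1) (evalEven X (v o)).2
    (gj := Sum.elim
      (fun ij : Fin m × Fin n => X.1.1 (.inl ij.1) (.inr ij.2))
      (fun ij : Fin n × Fin m => X.1.1 (.inr ij.1) (.inl ij.2)) o) (by
      rcases o with ⟨i, j⟩ | ⟨i, j⟩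
      · exact X.1.2 (.inl i) (.inr j)
      · exact X.1.2 (.inr i) (.inl j))
  rwa [zero_add] at h

theorem evalHom_mem (X : (evenSupermatrix 𝒜 m n)ˣ) (i : ZMod 2) (f : CoordRing K m n)
    (hf : f ∈ coordPart K m n i) : evalHom X f ∈ 𝒜 i := by
  change f ∈ CliffordAlgebra.evenOdd _ i at hf
  unfold CliffordAlgebra.evenOdd at hf
  induction hf using Submodule.iSup_induction' with
  | zero => rw [map_zero]; exact Submodule.zero_mem _
  | add a b _ _ ha hb => rw [map_add]; exact Submodule.add_mem _ ha hb
  | mem k f hf =>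
    obtain ⟨k, rfl⟩ := k
    dsimp only at hf
    induction hf using Submodule.pow_induction_on_left' with
    | algebraMap s =>
      have := evalHom_algebraMap X s
      rw [Nat.cast_zero]
      erw [this]
      exact (evalEven X s).2
    | add a b _ _ _ ha hb => rw [map_add]; exact Submodule.add_mem _ ha hb
    | mem_mul a ha k b _ hb =>
      obtain ⟨v, rfl⟩ := ha
      rw [map_mul, Nat.cast_succ, add_comm]
      exact SetLike.GradedMul.mul_mem (evalHom_ι_mem X v) hb

theorem toMatrix_evalHom (X : (evenSupermatrix 𝒜 m n)ˣ) :
    GLPoint.toMatrix ⟨evalHom X, evalHom_mem X⟩ = X.1 := by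
  have hX0 : ∀ ij, evalEven X (algebraMap (MvPolynomial (EvenIdx m n) K) _ (MvPolynomial.X ij)) =
      Sum.elim (fun ij => block00 X.1 ij.1 ij.2) (fun ij => block11 X.1 ij.1 ij.2) ij := fun ij =>
    (IsLocalization.lift_eq _ _).trans (MvPolynomial.aeval_X _ ij)
  have hX1 : ∀ o, evalHom X (ExteriorAlgebra.ι _ (Pi.single o 1)) = Sum.elim
      (fun ij : Fin m × Fin n => X.1.1 (.inl ij.1) (.inr ij.2))
      (fun ij : Fin n × Fin m => X.1.1 (.inr ij.1) (.inl ij.2)) o := by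
    intro o
    rw [evalHom_ι, Finset.sum_eq_single o]
    · simp
    · intro b _ hb
      simp [Pi.single_eq_of_ne hb]
    · simp
  apply Subtype.ext
  ext i j
  rcases i with i | i <;> rcases j with j | j
  · exact (evalHom_algebraMap X _).trans (congrArg Subtype.val (hX0 (.inl (i, j))))
  · exact hX1 (.inl (i, j))
  · exact hX1 (.inr (i, j))
  · exact (evalHom_algebraMap X _).trans (congrArg Subtype.val (hX0 (.inr (i, j))))

/-- The points of `G` over `A` are the invertible even supermatrices over `A`. -/
def GLPoint.equivUnits : GLPoint m n 𝒜 ≃ (evenSupermatrix 𝒜 m n)ˣ where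
  toFun g := g.isUnit_toMatrix.unit
  invFun X := ⟨evalHom X, evalHom_mem X⟩
  left_inv _ := GLPoint.ext_matrix (toMatrix_evalHom _)
  right_inv X := Units.ext (toMatrix_evalHom X)

/-- The group structure on `G(A)`: it is given by multiplication of supermatrices, i.e. by the
comultiplication `c_ij ↦ ∑ₖ c_ik ⊗ c_kj` of `K[G]`. -/
instance : Group (GLPoint m n 𝒜) := GLPoint.equivUnits.group

theorem GLPoint.toMatrix_mul (g h : GLPoint m n 𝒜) :
    (g * h).toMatrix = g.toMatrix * h.toMatrix :=
  congrArg Units.val (GLPoint.equivUnits.apply_symm_apply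
    (GLPoint.equivUnits g * GLPoint.equivUnits h))

end Points

/-! ### Invariants of the adjoint action -/

/-- `σ_i(M)`, the `i`-th coefficient of the characteristic polynomial of `M`, normalized by
`det(1 + tM) = ∑ i, σ_i(M) t^i`. -/
def sigma {R : Type*} [CommRing R] {r : ℕ} (i : ℕ) (M : Matrix (Fin r) (Fin r) R) : R :=
  (Matrix.det (1 + (Polynomial.X : Polynomial R) • M.map Polynomial.C)).coeff i

variable (K : Type u) [Field K] (m n : ℕ)

/-- The algebra `R` of invariants of the adjoint action of `G`: the `f ∈ K[G]` such that
`f(g₁⁻¹ g₂ g₁) = f(g₂)` for all commutative superalgebras `A` over `K` and all `g₁, g₂ ∈ G(A)`. -/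
def adjointInvariants : Subalgebra K (CoordRing K m n) where
  carrier := {f | ∀ (A : Type u) [Ring A] [Algebra K A] (𝒜 : ZMod 2 → Submodule K A)
    [GradedAlgebra 𝒜] [IsCommSuperalgebra 𝒜] (g₁ g₂ : GLPoint m n 𝒜),
    (g₁⁻¹ * g₂ * g₁).hom f = g₂.hom f}
  mul_mem' := fun ha hb A _ _ 𝒜 _ _ g₁ g₂ => by
    rw [map_mul, map_mul, ha A 𝒜 g₁ g₂, hb A 𝒜 g₁ g₂]
  add_mem' := fun ha hb A _ _ 𝒜 _ _ g₁ g₂ => by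
    rw [map_add, map_add, ha A 𝒜 g₁ g₂, hb A 𝒜 g₁ g₂]
  algebraMap_mem' := fun r A _ _ 𝒜 _ _ g₁ g₂ => by
    rw [AlgHom.commutes, AlgHom.commutes]

/-- The polynomial functions: the subalgebra `K[c_ij]` of `K[G]` generated by the `c_ij`. -/
def polynomialFunctions : Subalgebra K (CoordRing K m n) :=
  Algebra.adjoin K {f | ∃ i j, f = genericMatrix K m n i j}

/-- The algebra `R_pol` of polynomial invariants. -/
def polynomialInvariants : Subalgebra K (CoordRing K m n) :=
  adjointInvariants K m n ⊓ polynomialFunctions K m n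

end GLSuper

end

noncomputable section

namespace GLSuper

universe u

open Matrix

/-! ### Frobenius powers of the block determinants are multiplicative -/

section Determinant

/-! Since σ_m(C₀₀) = det C₀₀ and σ_n(C₁₁) = det C₁₁, the theorem rests on two facts: the p-th powers
of these determinants are adjoint invariants, and they are the only denominators needed.

Invariance comes from multiplicativity. For even supermatrices, (XY)₀₀ = X₀₀Y₀₀ + X₀₁Y₁₀, and each
entry of X₀₁Y₁₀ is a sum of products of two odd elements. Such a product lies in the commutative
even part and has square zero, so in characteristic p the Frobenius kills the sum. Hence (XY)₀₀ and
X₀₀Y₀₀ agree entrywise after p-th powers (`block00_mul_pow_char`). Because Frobenius commutes with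
determinants, X ↦ det(X₀₀)^p is a monoid homomorphism into a commutative monoid (`detPow00`), hence
constant on conjugacy classes. The block X₁₁ is treated in the same way, and inverses of invertible
invariants are again invariant (`inv_mem_adjointInvariants`).

For the denominators, K[G] is a localization, so every f is carried into K[c_ij] by all large powers
of d = det C₀₀ · det C₁₁ (`exists_pow_mul_mem_polynomialFunctions`). If f is invariant, choose the
exponent to be a multiple of p: then the power of d is itself invariant, and the product is a
polynomial invariant. Dividing back gives the required form of f. -/

theorem sigma_self_eq_det {R : Type*} [CommRing R] {r : ℕ} (M : Matrix (Fin r) (Fin r) R) :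
    sigma r M = M.det := by
  -- σ_r(M) is the coefficient of t^r in det(tM + 1), the top possible degree, where only the part
  -- tM contributes.
  have h := Polynomial.coeff_det_X_add_C_card M 1
  rw [Fintype.card_fin, Matrix.map_one _ (map_zero _) (map_one _), add_comm] at h
  exact h

variable {K : Type u} [Field K] {A : Type*} [Ring A] [Algebra K A]
  {𝒜 : ZMod 2 → Submodule K A} [GradedAlgebra 𝒜] [IsCommSuperalgebra 𝒜] {m n : ℕ}

/-- An even element is central, so (ab)² = a(ab)b = a²b², and b² = 0. The explicit exponent 2
matters: nilpotency of unknown order would not make the p-th power vanish. -/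
theorem odd_mul_odd_sq_zero {a b : A} (hb : b ∈ 𝒜 1) (h : a * b ∈ evenPart 𝒜) :
    (⟨a * b, h⟩ : evenPart 𝒜) ^ 2 = 0 := by
  refine Subtype.ext ?_
  change (a * b) ^ 2 = 0
  rw [pow_two, mul_assoc, ← even_comm 𝒜 h b, mul_assoc a b b,
    IsCommSuperalgebra.odd_sq_zero (𝒜 := 𝒜) b hb, mul_zero, mul_zero]

variable (p : ℕ) [Fact p.Prime] [CharP (evenPart 𝒜) p]

/-- In characteristic `p`, a sum of products of odd elements is killed by the Frobenius. -/
theorem sum_odd_mul_odd_pow_char {ι : Type*} (s : Finset ι) {a b : ι → A}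
    (hb : ∀ k, b k ∈ 𝒜 1) (h : ∀ k, a k * b k ∈ evenPart 𝒜) :
    (∑ k ∈ s, (⟨a k * b k, h k⟩ : evenPart 𝒜)) ^ p = 0 := by
  rw [sum_pow_char]
  exact Finset.sum_eq_zero fun k _ =>
    pow_eq_zero_of_le (Fact.out : p.Prime).two_le (odd_mul_odd_sq_zero (hb k) (h k))

/-- The two entries differ by an entry of X₀₁Y₁₀, which has p-th power zero, and Frobenius is
additive on the commutative even part. -/
theorem block00_mul_pow_char (X Y : evenSupermatrix 𝒜 m n) (i j) :
    block00 (X * Y) i j ^ p = (block00 X * block00 Y) i j ^ p := by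
  have hmem : ∀ k, X.1 (.inl i) (.inr k) * Y.1 (.inr k) (.inl j) ∈ evenPart 𝒜 := fun k =>
    SetLike.GradedMul.mul_mem (X.2 (.inl i) (.inr k)) (Y.2 (.inr k) (.inl j))
  have e : block00 (X * Y) i j = (block00 X * block00 Y) i j +
      ∑ k, (⟨_, hmem k⟩ : evenPart 𝒜) := by
    apply Subtype.ext
    simp [block00, Matrix.mul_apply]
  rw [e, add_pow_char,
    sum_odd_mul_odd_pow_char p Finset.univ (fun k => Y.2 (.inr k) (.inl j)) hmem, add_zero]

theorem block11_mul_pow_char (X Y : evenSupermatrix 𝒜 m n) (i j) :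
    block11 (X * Y) i j ^ p = (block11 X * block11 Y) i j ^ p := by
  have hmem : ∀ k, X.1 (.inr i) (.inl k) * Y.1 (.inl k) (.inr j) ∈ evenPart 𝒜 := fun k =>
    SetLike.GradedMul.mul_mem (X.2 (.inr i) (.inl k)) (Y.2 (.inl k) (.inr j))
  have e : block11 (X * Y) i j = (block11 X * block11 Y) i j +
      ∑ k, (⟨_, hmem k⟩ : evenPart 𝒜) := by
    apply Subtype.ext
    simp [block11, Matrix.mul_apply, add_comm]
  rw [e, add_pow_char,
    sum_odd_mul_odd_pow_char p Finset.univ (fun k => Y.2 (.inl k) (.inr j)) hmem, add_zero]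

/-- Frobenius is a ring endomorphism, so det(M)^p is the determinant of the matrix of p-th powers.
-/
theorem det_pow_char_congr {R ι : Type*} [CommRing R] [CharP R p] [Fintype ι] [DecidableEq ι]
    {M N : Matrix ι ι R} (h : ∀ i j, M i j ^ p = N i j ^ p) : M.det ^ p = N.det ^ p := by
  have e : M.map (frobenius R p) = N.map (frobenius R p) := Matrix.ext h
  have h0 := RingHom.map_det (frobenius R p) M
  have h1 := RingHom.map_det (frobenius R p) N
  simp only [RingHom.mapMatrix_apply, e] at h0 h1
  exact h0.trans h1.symm

/-- `X ↦ det(X₀₀)^p` is multiplicative in characteristic `p`. -/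
def detPow00 : evenSupermatrix 𝒜 m n →* evenPart 𝒜 where
  toFun X := (block00 X).det ^ p
  map_one' := by rw [block00_one, det_one, one_pow]
  map_mul' X Y := by
    rw [det_pow_char_congr p (block00_mul_pow_char p X Y), det_mul, mul_pow]

/-- `X ↦ det(X₁₁)^p` is multiplicative in characteristic `p`. -/
def detPow11 : evenSupermatrix 𝒜 m n →* evenPart 𝒜 where
  toFun X := (block11 X).det ^ p
  map_one' := by rw [block11_one, det_one, one_pow]
  map_mul' X Y := by
    rw [det_pow_char_congr p (block11_mul_pow_char p X Y), det_mul, mul_pow]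

theorem GLPoint.toMatrix_one : (1 : GLPoint m n 𝒜).toMatrix = 1 :=
  congrArg Units.val (GLPoint.equivUnits.apply_symm_apply 1)

/-- Homomorphisms from supermatrices to a commutative monoid are conjugation invariant. -/
theorem GLPoint.map_toMatrix_conj {M : Type*} [CommMonoid M] (φ : evenSupermatrix 𝒜 m n →* M)
    (g h : GLPoint m n 𝒜) : φ (g⁻¹ * h * g).toMatrix = φ h.toMatrix := by
  rw [GLPoint.toMatrix_mul, GLPoint.toMatrix_mul, map_mul, map_mul, mul_right_comm, ← map_mul,
    ← GLPoint.toMatrix_mul, inv_mul_cancel, GLPoint.toMatrix_one, map_one, one_mul]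

/-- Turns evaluation of the coordinate function det C₀₀ at a point into a function of its
supermatrix, to which `detPow00` applies. -/
theorem GLPoint.evenHom_det_C00 (g : GLPoint m n 𝒜) :
    g.evenHom (C00 K m n).det = (block00 g.toMatrix).det := by
  rw [AlgHom.map_det]
  rfl

theorem GLPoint.evenHom_det_C11 (g : GLPoint m n 𝒜) :
    g.evenHom (C11 K m n).det = (block11 g.toMatrix).det := by
  rw [AlgHom.map_det]
  rfl

end Determinant

/-! ### Adjoint invariance of the p-th powers and of inverses -/

section Invariants

variable (K : Type u) [Field K] (p : ℕ) [Fact p.Prime] [CharP K p] (m n : ℕ)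

/-- An even function whose values are invariant under conjugation is an adjoint invariant; it
suffices to test on nonzero superalgebras. -/
theorem algebraMap_mem_adjointInvariants (s : EvenCoord K m n)
    (h : ∀ (A : Type u) [Ring A] [Nontrivial A] [Algebra K A] (𝒜 : ZMod 2 → Submodule K A)
      [GradedAlgebra 𝒜] [IsCommSuperalgebra 𝒜] (g₁ g₂ : GLPoint m n 𝒜),
      (g₁⁻¹ * g₂ * g₁).evenHom s = g₂.evenHom s) :
    algebraMap _ (CoordRing K m n) s ∈ adjointInvariants K m n := by
  intro A _ _ 𝒜 _ _ g₁ g₂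
  rcases subsingleton_or_nontrivial A with _ | _
  · exact Subsingleton.elim _ _
  · exact congrArg Subtype.val (h A 𝒜 g₁ g₂)

theorem det_C00_pow_char_mem_adjointInvariants :
    algebraMap _ (CoordRing K m n) (C00 K m n).det ^ p ∈ adjointInvariants K m n := by
  rw [← map_pow]
  refine algebraMap_mem_adjointInvariants K m n _ fun A _ _ _ 𝒜 _ _ g₁ g₂ => ?_
  -- Nontriviality of A enters here: K then embeds in the even part, which inherits characteristic
  -- p. The zero ring would have characteristic 1.
  have : CharP (evenPart 𝒜) p := charP_of_injective_algebraMap (algebraMap K _).injective p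
  rw [map_pow, map_pow, GLPoint.evenHom_det_C00, GLPoint.evenHom_det_C00]
  exact GLPoint.map_toMatrix_conj (detPow00 p) g₁ g₂

theorem det_C11_pow_char_mem_adjointInvariants :
    algebraMap _ (CoordRing K m n) (C11 K m n).det ^ p ∈ adjointInvariants K m n := by
  rw [← map_pow]
  refine algebraMap_mem_adjointInvariants K m n _ fun A _ _ _ 𝒜 _ _ g₁ g₂ => ?_
  have : CharP (evenPart 𝒜) p := charP_of_injective_algebraMap (algebraMap K _).injective p
  rw [map_pow, map_pow, GLPoint.evenHom_det_C11, GLPoint.evenHom_det_C11]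
  exact GLPoint.map_toMatrix_conj (detPow11 p) g₁ g₂

variable {K m n} in
/-- The inverse of an invertible adjoint invariant is an adjoint invariant. -/
theorem inv_mem_adjointInvariants (u : (CoordRing K m n)ˣ)
    (hu : (u : CoordRing K m n) ∈ adjointInvariants K m n) :
    ((u⁻¹ : (CoordRing K m n)ˣ) : CoordRing K m n) ∈ adjointInvariants K m n := by
  intro A _ _ 𝒜 _ _ g₁ g₂
  -- The comparison is made in the unit group of A, where two homomorphisms that agree at u also
  -- agree at u⁻¹.
  have e : Units.map (g₁⁻¹ * g₂ * g₁).hom.toRingHom.toMonoidHom u =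
      Units.map g₂.hom.toRingHom.toMonoidHom u := Units.ext (hu A 𝒜 g₁ g₂)
  have h := congrArg (fun x : Aˣ => ((x⁻¹ : Aˣ) : A)) e
  simp only [← map_inv] at h
  exact h

end Invariants

/-! ### Polynomial functions and clearing of denominators -/

section Polynomial

variable (K : Type u) [Field K] (m n : ℕ)

theorem genericMatrix_mem_polynomialFunctions (i j : Fin m ⊕ Fin n) :
    genericMatrix K m n i j ∈ polynomialFunctions K m n :=
  Algebra.subset_adjoin ⟨i, j, rfl⟩

theorem algebraMap_mvPolynomial_mem_polynomialFunctions (q : MvPolynomial (EvenIdx m n) K) :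
    algebraMap (EvenCoord K m n) (CoordRing K m n) (algebraMap _ _ q) ∈
      polynomialFunctions K m n := by
  -- Viewing the two successive embeddings as one K-algebra map lets constants be recognised as
  -- scalars from K.
  have e : ∀ q : MvPolynomial (EvenIdx m n) K,
      algebraMap (EvenCoord K m n) (CoordRing K m n) (algebraMap _ _ q) =
        ((IsScalarTower.toAlgHom K (EvenCoord K m n) (CoordRing K m n)).comp
          (IsScalarTower.toAlgHom K (MvPolynomial (EvenIdx m n) K) (EvenCoord K m n))) q :=
    fun _ => rfl
  induction q using MvPolynomial.induction_on with
  | C r =>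
    rw [e, ← MvPolynomial.algebraMap_eq, AlgHom.commutes]
    exact Subalgebra.algebraMap_mem _ r
  | add a b ha hb =>
    rw [map_add, map_add]
    exact Subalgebra.add_mem _ ha hb
  | mul_X a o ha =>
    rw [map_mul, map_mul]
    refine Subalgebra.mul_mem _ ha ?_
    rcases o with ⟨i, j⟩ | ⟨i, j⟩
    · exact genericMatrix_mem_polynomialFunctions K m n (.inl i) (.inl j)
    · exact genericMatrix_mem_polynomialFunctions K m n (.inr i) (.inr j)

theorem det_C00_mem_polynomialFunctions :
    algebraMap _ (CoordRing K m n) (C00 K m n).det ∈ polynomialFunctions K m n := by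
  have e : (C00 K m n).det = algebraMap _ (EvenCoord K m n)
      (Matrix.of fun i j : Fin m =>
        (MvPolynomial.X (.inl (i, j)) : MvPolynomial (EvenIdx m n) K)).det :=
    (RingHom.map_det _ _).symm
  rw [e]
  exact algebraMap_mvPolynomial_mem_polynomialFunctions K m n _

theorem det_C11_mem_polynomialFunctions :
    algebraMap _ (CoordRing K m n) (C11 K m n).det ∈ polynomialFunctions K m n := by
  have e : (C11 K m n).det = algebraMap _ (EvenCoord K m n)
      (Matrix.of fun i j : Fin n =>
        (MvPolynomial.X (.inr (i, j)) : MvPolynomial (EvenIdx m n) K)).det :=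
    (RingHom.map_det _ _).symm
  rw [e]
  exact algebraMap_mvPolynomial_mem_polynomialFunctions K m n _

/-- Every element of `K[G]` becomes polynomial after multiplication by any sufficiently large
power of `det C₀₀ * det C₁₁`. -/
theorem exists_pow_mul_mem_polynomialFunctions (f : CoordRing K m n) :
    ∃ N : ℕ, ∀ k ≥ N, algebraMap _ _ ((C00 K m n).det * (C11 K m n).det) ^ k * f ∈
      polynomialFunctions K m n := by
  have hd : algebraMap _ (CoordRing K m n) ((C00 K m n).det * (C11 K m n).det) ∈
      polynomialFunctions K m n := by
    rw [map_mul]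
    exact Subalgebra.mul_mem _ (det_C00_mem_polynomialFunctions K m n)
      (det_C11_mem_polynomialFunctions K m n)
  -- Powers of d = det C₀₀ · det C₁₁ come from the even scalars, hence are central in the exterior
  -- algebra.
  have hcomm : ∀ (k : ℕ) (a : CoordRing K m n),
      a * algebraMap _ _ ((C00 K m n).det * (C11 K m n).det) ^ k =
        algebraMap _ _ ((C00 K m n).det * (C11 K m n).det) ^ k * a := fun k a => by
    rw [← map_pow]
    exact (Algebra.commutes _ a).symm
  have hmul : ∀ a b : CoordRing K m n,
      (∃ N : ℕ, ∀ k ≥ N, algebraMap _ _ ((C00 K m n).det * (C11 K m n).det) ^ k * a ∈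
        polynomialFunctions K m n) →
      (∃ N : ℕ, ∀ k ≥ N, algebraMap _ _ ((C00 K m n).det * (C11 K m n).det) ^ k * b ∈
        polynomialFunctions K m n) →
      ∃ N : ℕ, ∀ k ≥ N, algebraMap _ _ ((C00 K m n).det * (C11 K m n).det) ^ k * (a * b) ∈
        polynomialFunctions K m n := by
    rintro a b ⟨N, hN⟩ ⟨M, hM⟩
    refine ⟨N + M, fun k hk => ?_⟩
    -- Write k = N + l with l ≥ M; centrality gives d^k ab = (d^N a)(d^l b).
    obtain ⟨l, rfl⟩ := Nat.exists_eq_add_of_le (le_trans (Nat.le_add_right N M) hk)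
    rw [pow_add, mul_assoc, ← mul_assoc _ a b, ← hcomm l a, mul_assoc, ← mul_assoc]
    exact Subalgebra.mul_mem _ (hN N le_rfl) (hM l (by omega))
  have hscalar : ∀ s : EvenCoord K m n, ∃ N : ℕ, ∀ k ≥ N,
      algebraMap _ _ ((C00 K m n).det * (C11 K m n).det) ^ k *
        algebraMap _ (CoordRing K m n) s ∈ polynomialFunctions K m n := by
    intro s
    -- A scalar is a fraction with denominator d^N; any further factors of d are themselves
    -- polynomial.
    obtain ⟨N, q, hq⟩ := IsLocalization.Away.surj (detProd K m n) s
    refine ⟨N, fun k hk => ?_⟩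
    obtain ⟨l, rfl⟩ := Nat.exists_eq_add_of_le hk
    have e : algebraMap (EvenCoord K m n) (CoordRing K m n)
        ((C00 K m n).det * (C11 K m n).det) ^ N * algebraMap _ _ s =
        algebraMap _ _ (algebraMap _ (EvenCoord K m n) q) := by
      rw [← hq, algebraMap_detProd, map_mul (algebraMap _ (CoordRing K m n)) s, map_pow]
      exact (hcomm _ _).symm
    rw [add_comm, pow_add, mul_assoc, e]
    exact Subalgebra.mul_mem _ (Subalgebra.pow_mem _ hd l)
      (algebraMap_mvPolynomial_mem_polynomialFunctions K m n q)
  have hadd : ∀ a b : CoordRing K m n,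
      (∃ N : ℕ, ∀ k ≥ N, algebraMap _ _ ((C00 K m n).det * (C11 K m n).det) ^ k * a ∈
        polynomialFunctions K m n) →
      (∃ N : ℕ, ∀ k ≥ N, algebraMap _ _ ((C00 K m n).det * (C11 K m n).det) ^ k * b ∈
        polynomialFunctions K m n) →
      ∃ N : ℕ, ∀ k ≥ N, algebraMap _ _ ((C00 K m n).det * (C11 K m n).det) ^ k * (a + b) ∈
        polynomialFunctions K m n := by
    rintro a b ⟨N, hN⟩ ⟨M, hM⟩
    refine ⟨max N M, fun k hk => ?_⟩
    rw [mul_add]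
    exact Subalgebra.add_mem _ (hN k (le_trans (le_max_left _ _) hk))
      (hM k (le_trans (le_max_right _ _) hk))
  induction f using ExteriorAlgebra.induction with
  | algebraMap s => exact hscalar s
  | ι x =>
    rw [pi_eq_sum_univ' x, map_sum]
    refine Finset.sum_induction _ (fun a => ∃ N : ℕ, ∀ k ≥ N,
      algebraMap _ _ ((C00 K m n).det * (C11 K m n).det) ^ k * a ∈ polynomialFunctions K m n)
      hadd ⟨0, fun k _ => by rw [mul_zero]; exact Subalgebra.zero_mem _⟩ fun o _ => ?_
    rw [map_smul, Algebra.smul_def]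
    -- Only the coefficient may have a denominator: the basis vector is an odd c_ij, so exponent 0
    -- suffices for it.
    refine hmul _ _ (hscalar _) ⟨0, fun k _ => Subalgebra.mul_mem _ (Subalgebra.pow_mem _ hd k) ?_⟩
    rcases o with ⟨i, j⟩ | ⟨i, j⟩
    · exact genericMatrix_mem_polynomialFunctions K m n (.inl i) (.inr j)
    · exact genericMatrix_mem_polynomialFunctions K m n (.inr i) (.inl j)
  | mul a b ha hb => exact hmul a b ha hb
  | add a b ha hb => exact hadd a b ha hb

end Polynomial

end GLSuper

end

/-! ### The description of R by polynomial invariants -/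

theorem mainTheorem4 {K : Type*} [Field K] [IsAlgClosed K] (p : ℕ) [Fact p.Prime] [CharP K p]
    (hp : p ≠ 2) (m n : ℕ) :
    ∃ u v : (GLSuper.CoordRing K m n)ˣ,
      (u : GLSuper.CoordRing K m n) = algebraMap _ _ (GLSuper.sigma m (GLSuper.C00 K m n)) ∧
      (v : GLSuper.CoordRing K m n) = algebraMap _ _ (GLSuper.sigma n (GLSuper.C11 K m n)) ∧
      ((u ^ p : (GLSuper.CoordRing K m n)ˣ) : GLSuper.CoordRing K m n) ∈
        GLSuper.polynomialInvariants K m n ∧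
      ((v ^ p : (GLSuper.CoordRing K m n)ˣ) : GLSuper.CoordRing K m n) ∈
        GLSuper.polynomialInvariants K m n ∧
      GLSuper.adjointInvariants K m n =
        Algebra.adjoin K ((GLSuper.polynomialInvariants K m n : Set (GLSuper.CoordRing K m n)) ∪
          {((u ^ p : (GLSuper.CoordRing K m n)ˣ) : GLSuper.CoordRing K m n),
           (((u ^ p)⁻¹ : (GLSuper.CoordRing K m n)ˣ) : GLSuper.CoordRing K m n),
           ((v ^ p : (GLSuper.CoordRing K m n)ˣ) : GLSuper.CoordRing K m n),
           (((v ^ p)⁻¹ : (GLSuper.CoordRing K m n)ˣ) : GLSuper.CoordRing K m n)}) ∧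
      ∀ f : GLSuper.CoordRing K m n, f ∈ GLSuper.adjointInvariants K m n ↔
        ∃ a ∈ GLSuper.polynomialInvariants K m n, ∃ k l : ℕ,
          f = a * ((((u ^ p)⁻¹) ^ k * ((v ^ p)⁻¹) ^ l : (GLSuper.CoordRing K m n)ˣ) :
            GLSuper.CoordRing K m n) := by
  have hu0 := GLSuper.sigma_self_eq_det (GLSuper.C00 K m n)
  have hv0 := GLSuper.sigma_self_eq_det (GLSuper.C11 K m n)
  obtain ⟨u, hu⟩ := (GLSuper.isUnit_det_C00 K m n).map (algebraMap _ (GLSuper.CoordRing K m n))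
  obtain ⟨v, hv⟩ := (GLSuper.isUnit_det_C11 K m n).map (algebraMap _ (GLSuper.CoordRing K m n))
  have huR : ((u ^ p : (GLSuper.CoordRing K m n)ˣ) : GLSuper.CoordRing K m n) ∈ GLSuper.adjointInvariants K m n := by
    rw [Units.val_pow_eq_pow_val, hu]
    exact GLSuper.det_C00_pow_char_mem_adjointInvariants K p m n
  have hvR : ((v ^ p : (GLSuper.CoordRing K m n)ˣ) : GLSuper.CoordRing K m n) ∈ GLSuper.adjointInvariants K m n := by
    rw [Units.val_pow_eq_pow_val, hv]
    exact GLSuper.det_C11_pow_char_mem_adjointInvariants K p m n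
  have huP : ((u ^ p : (GLSuper.CoordRing K m n)ˣ) : GLSuper.CoordRing K m n) ∈ GLSuper.polynomialInvariants K m n := by
    refine ⟨huR, ?_⟩
    rw [Units.val_pow_eq_pow_val, hu]
    exact Subalgebra.pow_mem _ (GLSuper.det_C00_mem_polynomialFunctions K m n) p
  have hvP : ((v ^ p : (GLSuper.CoordRing K m n)ˣ) : GLSuper.CoordRing K m n) ∈ GLSuper.polynomialInvariants K m n := by
    refine ⟨hvR, ?_⟩
    rw [Units.val_pow_eq_pow_val, hv]
    exact Subalgebra.pow_mem _ (GLSuper.det_C11_mem_polynomialFunctions K m n) p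
  have huI := GLSuper.inv_mem_adjointInvariants _ huR
  have hvI := GLSuper.inv_mem_adjointInvariants _ hvR
  have hpol : ∀ f ∈ GLSuper.adjointInvariants K m n, ∃ a ∈ GLSuper.polynomialInvariants K m n, ∃ k l : ℕ,
      f = a * ((((u ^ p)⁻¹) ^ k * ((v ^ p)⁻¹) ^ l : (GLSuper.CoordRing K m n)ˣ) : GLSuper.CoordRing K m n) := by
    intro f hf
    obtain ⟨N, hN⟩ := GLSuper.exists_pow_mul_mem_polynomialFunctions K m n f
    -- The exponent is raised to a multiple of p so that the clearing factor is (u^p)^N (v^p)^N,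
    -- which is an invariant.
    have hN := hN (p * N) (Nat.le_mul_of_pos_left N (Fact.out : p.Prime).pos)
    -- K[G] need not be commutative as a ring, so its units need not commute; u and v do, being
    -- images of even scalars.
    have hcu : (u : GLSuper.CoordRing K m n) * v = v * u := by
      rw [hu, hv]
      exact Algebra.commutes _ _
    have hcomm : Commute u v := Units.ext hcu
    have hval : algebraMap _ (GLSuper.CoordRing K m n) ((GLSuper.C00 K m n).det * (GLSuper.C11 K m n).det) ^ (p * N) =
        (((u ^ p) ^ N * (v ^ p) ^ N : (GLSuper.CoordRing K m n)ˣ) : GLSuper.CoordRing K m n) := by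
      rw [map_mul, ← hu, ← hv, ← pow_mul, ← pow_mul, ← hcomm.mul_pow, Units.val_pow_eq_pow_val,
        Units.val_mul]
    -- The numerator is invariant as a product of invariants and polynomial by the choice of N; both
    -- denominators get the same exponent N.
    refine ⟨f * (((u ^ p) ^ N * (v ^ p) ^ N : (GLSuper.CoordRing K m n)ˣ) : GLSuper.CoordRing K m n),
      ⟨?_, ?_⟩, N, N, ?_⟩
    · refine Subalgebra.mul_mem _ hf ?_
      rw [Units.val_mul, Units.val_pow_eq_pow_val (u ^ p), Units.val_pow_eq_pow_val (v ^ p)]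
      exact Subalgebra.mul_mem _ (Subalgebra.pow_mem _ huR N) (Subalgebra.pow_mem _ hvR N)
    · rw [← hval, ← map_pow, ← Algebra.commutes, map_pow]
      exact hN
    · have hcN : Commute ((u ^ p) ^ N) ((v ^ p) ^ N) :=
        ((hcomm.pow_pow p p).pow_pow N N)
      rw [mul_assoc, ← Units.val_mul, inv_pow, inv_pow, hcN.eq, mul_assoc,
        mul_inv_cancel_left, mul_inv_cancel, Units.val_one, mul_one]
  refine ⟨u, v, hu0 ▸ hu, hv0 ▸ hv, huP, hvP, le_antisymm ?_ ?_, fun f => ⟨hpol f, ?_⟩⟩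
  · intro f hf
    obtain ⟨a, ha, k, l, rfl⟩ := hpol f hf
    rw [Units.val_mul, Units.val_pow_eq_pow_val (u ^ p)⁻¹, Units.val_pow_eq_pow_val (v ^ p)⁻¹]
    refine Subalgebra.mul_mem _ (Algebra.subset_adjoin (.inl ha)) (Subalgebra.mul_mem _
      (Subalgebra.pow_mem _ (Algebra.subset_adjoin (.inr ?_)) k)
      (Subalgebra.pow_mem _ (Algebra.subset_adjoin (.inr ?_)) l))
    · exact .inr (.inl rfl)
    · exact .inr (.inr (.inr rfl))
  · refine Algebra.adjoin_le ?_
    rintro f (hf | rfl | rfl | rfl | rfl)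
    · exact hf.1
    · exact huR
    · exact huI
    · exact hvR
    · exact hvI
  · rintro ⟨a, ha, k, l, rfl⟩
    rw [Units.val_mul, Units.val_pow_eq_pow_val (u ^ p)⁻¹, Units.val_pow_eq_pow_val (v ^ p)⁻¹]
    exact Subalgebra.mul_mem _ ha.1 (Subalgebra.mul_mem _ (Subalgebra.pow_mem _ huI k)
      (Subalgebra.pow_mem _ hvI l))
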